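/- Let $(A,\mu)$ be a Lie algebroid over a smooth manifold $M$, with anchor $\rho$ and bracket $[\ ,\ ]^\mu$, let $N:A\to A$ be a vector bundle endomorphism with transpose ${}^tN:A^*\to A^*$, and let $\omega$ be a $2$-form on $A$, viewed as a bundle map $\omega:A\to A^*$, $\langle\omega X,Y\rangle=\omega(X,Y)$, such that $\omega N={}^tN\omega$. Assume that $(\omega,N)$ is an $\Omega N$-structure on $(A,\mu)$: the Nijenhuis torsion $$T_\mu N(X,Y)=[NX,NY]^\mu-N\big([NX,Y]^\mu+[X,NY]^\mu-N[X,Y]^\mu\big)$$ vanishes, and the $2$-forms $\omega$ and $\omega_N=\omega(N\,\cdot\,,\,\cdot\,)$ are closed for the Lie algebroid differential $d_\mu$. Let $E=A\oplus A^*$ with $\langle X+\xi,Y+\eta\rangle=\langle\xi,Y\rangle+\langle\eta,X\rangle$. Let $\mathcal A$ be the graded algebra of functions on $T^*[2]A[1]$, with its canonical Poisson bracket $\{\ ,\ \}$ of degree $-2$, so that $\mathcal A^0=C^\infty(M)$, $\mathcal A^1=\Gamma(E)$ and $\{u,v\}=\langle u,v\rangle$ for $u,v\in\Gamma(E)$.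 Let $\mu\in\mathcal A^3$ denote also the element defining the Courant algebroid $(A\oplus A^*,\mu)$, the double of the trivial Lie bialgebroid $((A,\mu),(A^*,0))$: thus $\{\mu,\mu\}=0$, the anchor is $\{\{X+\xi,\mu\},f\}=\rho(X)f$ and the Dorfman bracket is $\{\{X+\xi,\mu\},Y+\eta\}=[X,Y]^\mu+\mathcal L_X\eta-i_Yd_\mu\xi$. Then the endomorphism $\mathcal N=\begin{pmatrix}N&0\\ \omega&-{}^tN\end{pmatrix}$ of $A\oplus A^*$ is skew-symmetric for $\langle\ ,\ \rangle$, and it is a weak deforming tensor for $(A\oplus A^*,\mu)$: if $\widetilde{\mathcal N}\in\mathcal A^2$ is the element with $\mathcal N u=\{u,\widetilde{\mathcal N}\}$ for all $u\in\Gamma(E)$ and $\{\widetilde{\mathcal N},f\}=0$ for all $f\in C^\infty(M)$, then $$\{\mu,\{\{\widetilde{\mathcal N},\mu\},\widetilde{\mathcal N}\}\}=0 .$$ -/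

import Mathlib

open scoped Manifold ContDiff Bundle

noncomputable section

universe u

namespace CourantDeformation

/-! ## The graded Poisson algebra of a vector bundle with a fibrewise metric

`R` stands for the smooth functions on the base, `E` for the module of sections of a vector bundle
with a fibrewise nondegenerate symmetric bilinear form `B`.  The graded algebra `𝒜` of functions
on the minimal symplectic realization of `(E, B)` has `𝒜⁰ = R` and `𝒜¹ = E`, and its canonical
Poisson bracket `{ , }`, of degree `-2`, satisfies `{R, R} = {R, E} = 0` and `{u, v} = B u v`.
A function `C` of degree `n + 2` is determined by the two maps
`u ↦ {C, u} ∈ 𝒜ⁿ⁺¹` (for `u ∈ E`) and `f ↦ {C, f} ∈ 𝒜ⁿ` (for `f ∈ R`), and a pair of such maps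
comes from a function exactly when it satisfies the conditions listed in `IsFun` below.
This is how the elements of `𝒜` are represented. -/

section GradedPoisson

variable (R E : Type u) [CommRing R] [AddCommGroup E] [Module R E]

/-- Ambient space of symbols of degree `n`: for `n + 2` it consists of all pairs of maps
`(u ↦ {C, u}, f ↦ {C, f})`.  The functions of degree `n` are those that satisfy `IsFun`. -/
def Symb : ℕ → Type u
  | 0 => R
  | 1 => E
  | n + 2 => (E → Symb (n + 1)) × (R → Symb n)

instance Symb.instAddCommGroup : (n : ℕ) → AddCommGroup (Symb R E n)
  | 0 => inferInstanceAs (AddCommGroup R)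
  | 1 => inferInstanceAs (AddCommGroup E)
  | n + 2 =>
    letI := Symb.instAddCommGroup (n + 1)
    letI := Symb.instAddCommGroup n
    inferInstanceAs (AddCommGroup ((E → Symb R E (n + 1)) × (R → Symb R E n)))

instance Symb.instModule : (n : ℕ) → Module R (Symb R E n)
  | 0 => inferInstanceAs (Module R R)
  | 1 => inferInstanceAs (Module R E)
  | n + 2 =>
    letI := Symb.instModule (n + 1)
    letI := Symb.instModule n
    inferInstanceAs (Module R ((E → Symb R E (n + 1)) × (R → Symb R E n)))

variable {R E}

/-- `{C, u}` for `C` of degree `n + 2` and `u` in `𝒜¹ = E`. -/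
def Symb.onE {n : ℕ} (C : Symb R E (n + 2)) (u : E) : Symb R E (n + 1) := C.1 u

/-- `{C, f}` for `C` of degree `n + 2` and `f` in `𝒜⁰ = R`. -/
def Symb.onR {n : ℕ} (C : Symb R E (n + 2)) (f : R) : Symb R E n := C.2 f

/-- The element of degree `n + 2` with prescribed brackets with `𝒜¹` and `𝒜⁰`. -/
def Symb.mk {n : ℕ} (c : E → Symb R E (n + 1)) (s : R → Symb R E n) : Symb R E (n + 2) := (c, s)

/-- Transport along an equality of degrees. -/
def Symb.cast {n m : ℕ} (e : n = m) (C : Symb R E n) : Symb R E m := e ▸ C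

variable (B : LinearMap.BilinForm R E)

/-- The Poisson bracket `{C, D} ∈ 𝒜ᵏ` of `C ∈ 𝒜ⁿ` and `D ∈ 𝒜ᵐ`, where `k = n + m - 2`.  It is
graded antisymmetric, `{C, D} = -(-1)^(n m) {D, C}`, and for `n, m ≥ 2` it is determined by the
graded Jacobi identity:
`{{C, D}, u} = {C, {D, u}} + (-1)^m {{C, u}, D}` for `u ∈ 𝒜¹`, and
`{{C, D}, f} = {C, {D, f}} + {{C, f}, D}` for `f ∈ 𝒜⁰`. -/
def pbr : (k n m : ℕ) → n + m = k + 2 → Symb R E n → Symb R E m → Symb R E k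
  | _, 0, 0, h, _, _ => absurd h (by omega)
  | _, 0, 1, h, _, _ => absurd h (by omega)
  | _, 1, 0, h, _, _ => absurd h (by omega)
  | k, 0, m + 2, h, f, D => -(Symb.cast (by omega : m = k) (Symb.onR D f))
  | k, n + 2, 0, h, C, f => Symb.cast (by omega : n = k) (Symb.onR C f)
  | k, 1, 1, h, u, v => Symb.cast (by omega : 0 = k) (B u v : R)
  | k, 1, m + 2, h, u, D =>
    -((-1 : ℤ) ^ (m + 2) • Symb.cast (by omega : m + 1 = k) (Symb.onE D u))
  | k, n + 2, 1, h, C, u => Symb.cast (by omega : n + 1 = k) (Symb.onE C u)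
  | 0, n + 2, m + 2, h, _, _ => absurd h (by omega)
  | 1, n + 2, m + 2, h, _, _ => absurd h (by omega)
  | k + 2, n + 2, m + 2, h, C, D =>
    Symb.mk
      (fun u => pbr (k + 1) (n + 2) (m + 1) (by omega) C (Symb.onE D u)
        + (-1 : ℤ) ^ (m + 2) • pbr (k + 1) (n + 1) (m + 2) (by omega) (Symb.onE C u) D)
      (fun f => pbr k (n + 2) m (by omega) C (Symb.onR D f)
        + pbr k n (m + 2) (by omega) (Symb.onR C f) D)

/-- `{C, u}` for `C` of degree `n + 1` and `u ∈ 𝒜¹`. -/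
def pbrE : {n : ℕ} → Symb R E (n + 1) → E → Symb R E n
  | 0, v, u => B v u
  | _ + 1, C, u => Symb.onE C u

/-- For `C` of degree `n + 2`: `{{C, u}, f} = {{C, f}, u}` for all `u ∈ 𝒜¹`, `f ∈ 𝒜⁰`
(no condition if `n = 0`, both sides having degree `-1`). -/
def CommER : {n : ℕ} → Symb R E (n + 2) → Prop
  | 0, _ => True
  | _ + 1, C => ∀ u f, Symb.onR (Symb.onE C u) f = pbrE B (Symb.onR C f) u

/-- For `C` of degree `n + 2`: `{{C, f}, g} = {{C, g}, f}` for all `f, g ∈ 𝒜⁰`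
(no condition if `n < 2`, both sides having negative degree). -/
def CommRR : {n : ℕ} → Symb R E (n + 2) → Prop
  | 0, _ => True
  | 1, _ => True
  | _ + 2, C => ∀ f g, Symb.onR (Symb.onR C f) g = Symb.onR (Symb.onR C g) f

variable [Algebra ℝ R]

/-- `IsFun B n C`: the symbol `C` is an element of `𝒜ⁿ`.  In degree `n + 2` this says that
`u ↦ {C, u}` and `f ↦ {C, f}` take values in `𝒜ⁿ⁺¹` and `𝒜ⁿ`, that they are `ℝ`-linear, that
`{C, f g} = f {C, g} + g {C, f}`, and that the graded Jacobi identity holds for `C` and any two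
elements of `𝒜⁰ ∪ 𝒜¹`; the first of the Jacobi identities is
`{{C, u}, v} + {{C, v}, u} = {C, B u v}`.  (The Leibniz rule
`{C, f u} = f {C, u} + {C, f} u` then follows from the nondegeneracy of `B`.) -/
def IsFun : (n : ℕ) → Symb R E n → Prop
  | 0, _ => True
  | 1, _ => True
  | n + 2, C =>
    (∀ u, IsFun (n + 1) (Symb.onE C u)) ∧
    (∀ f, IsFun n (Symb.onR C f)) ∧
    (∀ u v, Symb.onE C (u + v) = Symb.onE C u + Symb.onE C v) ∧
    (∀ (t : ℝ) u, Symb.onE C (algebraMap ℝ R t • u) = algebraMap ℝ R t • Symb.onE C u) ∧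
    (∀ f g, Symb.onR C (f + g) = Symb.onR C f + Symb.onR C g) ∧
    (∀ (t : ℝ) f, Symb.onR C (algebraMap ℝ R t * f) = algebraMap ℝ R t • Symb.onR C f) ∧
    (∀ f g, Symb.onR C (f * g) = f • Symb.onR C g + g • Symb.onR C f) ∧
    (∀ u v, pbrE B (Symb.onE C u) v + pbrE B (Symb.onE C v) u = Symb.onR C (B u v)) ∧
    CommER B C ∧ CommRR C

/-- A Courant algebroid structure on `(E, B)`: an element `Θ ∈ 𝒜³` with `{Θ, Θ} = 0`.  The anchor
is `ρ(u) f = {{u, Θ}, f}` and the Dorfman bracket is `[u, v] = {{u, Θ}, v}`. -/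
def IsCourantStructure (Θ : Symb R E 3) : Prop :=
  IsFun B 3 Θ ∧ pbr B 4 3 3 rfl Θ Θ = 0

/-- `𝒩` is skew-symmetric (infinitesimally orthogonal) for `B`. -/
def IsSkew (𝒩 : E →ₗ[R] E) : Prop := ∀ u v, B (𝒩 u) v + B u (𝒩 v) = 0

/-- The element `Ñ ∈ 𝒜²` attached to a skew-symmetric endomorphism `𝒩`: the one with
`𝒩 u = {u, Ñ} = -{Ñ, u}` for `u ∈ 𝒜¹`, and `{Ñ, f} = 0` for `f ∈ 𝒜⁰`. -/
def tildeEnd (𝒩 : E →ₗ[R] E) : Symb R E 2 := Symb.mk (fun u => -(𝒩 u)) (fun _ => 0)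

/-- A skew-symmetric endomorphism `𝒩` of the Courant algebroid `(E, B, Θ)` is a weak deforming
tensor for `Θ` if `{{Ñ, Θ}, Ñ}` is a cocycle of `d_Θ = {Θ, · }`. -/
def IsWeakDeformingTensor (Θ : Symb R E 3) (𝒩 : E →ₗ[R] E) : Prop :=
  IsCourantStructure B Θ ∧ IsSkew B 𝒩 ∧
    pbr B 4 3 3 rfl Θ
      (pbr B 3 3 2 rfl (pbr B 3 2 3 rfl (tildeEnd 𝒩) Θ) (tildeEnd 𝒩)) = 0

/-- The identity `𝒩 u = {u, Ñ}`. -/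
theorem pbr_tildeEnd (𝒩 : E →ₗ[R] E) (u : E) :
    (pbr B 1 1 2 rfl u (tildeEnd 𝒩) : E) = 𝒩 u := by
  simp only [pbr, tildeEnd, Symb.mk, Symb.onE, Symb.cast]
  exact (by simp : -((-1 : ℤ) ^ 2 • -(𝒩 u)) = 𝒩 u)

theorem isFun_tildeEnd (hB : ∀ u v, B u v = B v u) {𝒩 : E →ₗ[R] E} (h : IsSkew B 𝒩) :
    IsFun B 2 (tildeEnd 𝒩) := by
  refine ⟨fun _ => trivial, fun _ => trivial, fun u v => ?_, fun t u => ?_, fun f g => ?_,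
    fun t f => ?_, fun f g => ?_, fun u v => ?_, trivial, trivial⟩
  · exact (by simp [add_comm] : -(𝒩 (u + v)) = -(𝒩 u) + -(𝒩 v))
  · exact (by simp : -(𝒩 (algebraMap ℝ R t • u)) = algebraMap ℝ R t • -(𝒩 u))
  · exact (add_zero (0 : R)).symm
  · exact (smul_zero (algebraMap ℝ R t) : _ • (0 : R) = 0).symm
  · exact (by simp : (0 : R) = f • (0 : R) + g • (0 : R))
  · refine (?_ : B (-(𝒩 u)) v + B (-(𝒩 v)) u = 0)
    have := h u v
    rw [hB u] at this
    simp only [map_neg, LinearMap.neg_apply]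
    linear_combination -this

end GradedPoisson

/-! ## Lie algebroids -/

section LieAlgebroid

open Bundle

variable {EM : Type*} [NormedAddCommGroup EM] [NormedSpace ℝ EM]
  {M : Type u} [TopologicalSpace M] [ChartedSpace EM M]
  {F : Type*} [NormedAddCommGroup F] [NormedSpace ℝ F]
  {A : M → Type u} [TopologicalSpace (TotalSpace F A)]
  [∀ x, AddCommGroup (A x)] [∀ x, Module ℝ (A x)] [∀ x, TopologicalSpace (A x)]
  [FiberBundle F A] [VectorBundle ℝ F A]

/-- Sections of a smooth vector bundle form a module over the smooth functions, pointwise. -/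
instance sectionSMul : SMul C^∞⟮𝓘(ℝ, EM), M; ℝ⟯ Cₛ^∞⟮𝓘(ℝ, EM); F, A⟯ :=
  ⟨fun f X => ⟨fun x => f x • X x, f.contMDiff.smul_section X.contMDiff⟩⟩

instance sectionModule : Module C^∞⟮𝓘(ℝ, EM), M; ℝ⟯ Cₛ^∞⟮𝓘(ℝ, EM); F, A⟯ where
  one_smul X := by ext x; exact one_smul ℝ (X x)
  mul_smul f g X := by ext x; exact mul_smul (f x) (g x) (X x)
  smul_zero f := by ext x; exact smul_zero (f x)
  smul_add f X Y := by ext x; exact smul_add (f x) (X x) (Y x)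
  add_smul f g X := by ext x; exact add_smul (f x) (g x) (X x)
  zero_smul X := by ext x; exact zero_smul ℝ (X x)

variable (EM F A) in
/-- The smooth sections of `A`. -/
abbrev Sec := Cₛ^∞⟮𝓘(ℝ, EM); F, A⟯

variable (EM F A) in
/-- The smooth sections of the dual bundle `A*`, as the `C^∞(M)`-linear functionals on the
sections of `A` (for a bundle of finite rank over a Hausdorff, second countable manifold, every
such functional is given by a unique smooth section of `A*`). -/
abbrev DualSec := Module.Dual C^∞⟮𝓘(ℝ, EM), M; ℝ⟯ (Sec EM F A)

variable [∀ x, IsTopologicalAddGroup (A x)] [∀ x, ContinuousSMul ℝ (A x)]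
variable [IsManifold 𝓘(ℝ, EM) ∞ M] [ContMDiffVectorBundle ∞ F A 𝓘(ℝ, EM)]

variable (EM F A) in
/-- Vector bundle endomorphisms of `A` over the identity: smooth sections of `Hom(A, A)`. -/
abbrev BundleEnd := Cₛ^∞⟮𝓘(ℝ, EM); F →L[ℝ] F, fun x => A x →L[ℝ] A x⟯

variable (EM F A) in
/-- Smooth fibrewise bilinear forms on `A`. -/
abbrev BundleBilin := Cₛ^∞⟮𝓘(ℝ, EM); F →L[ℝ] F →L[ℝ] ℝ, fun x => A x →L[ℝ] A x →L[ℝ] ℝ⟯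

variable (EM F A) in
/-- Vector bundle maps `A → TM` over the identity. -/
abbrev BundleAnchor := Cₛ^∞⟮𝓘(ℝ, EM); F →L[ℝ] EM, fun x => A x →L[ℝ] TangentSpace 𝓘(ℝ, EM) x⟯

/-- The function `x ↦ df_x (ρ_x (X x))`, derivative of `f` along the vector field `ρ X`. -/
def lieDer (ρ : BundleAnchor EM F A) (X : Sec EM F A) (f : C^∞⟮𝓘(ℝ, EM), M; ℝ⟯) :
    C^∞⟮𝓘(ℝ, EM), M; ℝ⟯ :=
  ⟨fun x => mfderiv 𝓘(ℝ, EM) 𝓘(ℝ, ℝ) f x (ρ x (X x)), by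
    have h1 : ContMDiff 𝓘(ℝ, EM) (𝓘(ℝ, EM).prod 𝓘(ℝ, EM)) ∞
        (fun x => TotalSpace.mk' EM x (ρ x (X x)) : M → TangentBundle 𝓘(ℝ, EM) M) :=
      ρ.contMDiff.clm_bundle_apply X.contMDiff
    have h2 := (f.contMDiff.contMDiff_tangentMap (m := ∞) (by simp)).comp h1
    exact (contMDiff_snd_tangentBundle_modelSpace ℝ 𝓘(ℝ, ℝ)).comp h2⟩

theorem lieDer_add_left (ρ : BundleAnchor EM F A) (X Y : Sec EM F A)
    (f : C^∞⟮𝓘(ℝ, EM), M; ℝ⟯) : lieDer ρ (X + Y) f = lieDer ρ X f + lieDer ρ Y f := by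
  ext x
  exact (congrArg (mfderiv 𝓘(ℝ, EM) 𝓘(ℝ, ℝ) f x) (map_add (ρ x) (X x) (Y x))).trans
    (map_add (mfderiv 𝓘(ℝ, EM) 𝓘(ℝ, ℝ) f x) (ρ x (X x)) (ρ x (Y x)))

theorem lieDer_smul_left (ρ : BundleAnchor EM F A) (g : C^∞⟮𝓘(ℝ, EM), M; ℝ⟯) (X : Sec EM F A)
    (f : C^∞⟮𝓘(ℝ, EM), M; ℝ⟯) : lieDer ρ (g • X) f = g * lieDer ρ X f := by
  ext x
  exact (congrArg (mfderiv 𝓘(ℝ, EM) 𝓘(ℝ, ℝ) f x) (map_smul (ρ x) (g x) (X x))).trans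
    (map_smul (mfderiv 𝓘(ℝ, EM) 𝓘(ℝ, ℝ) f x) (g x) (ρ x (X x)))

theorem lieDer_add (ρ : BundleAnchor EM F A) (X : Sec EM F A) (f g : C^∞⟮𝓘(ℝ, EM), M; ℝ⟯) :
    lieDer ρ X (f + g) = lieDer ρ X f + lieDer ρ X g := by
  ext x
  have hf : MDifferentiableAt 𝓘(ℝ, EM) 𝓘(ℝ, ℝ) f x := f.contMDiff.mdifferentiable (by simp) x
  have hg : MDifferentiableAt 𝓘(ℝ, EM) 𝓘(ℝ, ℝ) g x := g.contMDiff.mdifferentiable (by simp) x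
  exact congrArg (fun l => l (ρ x (X x))) (mfderiv_add hf hg)

theorem lieDer_mul (ρ : BundleAnchor EM F A) (X : Sec EM F A) (f g : C^∞⟮𝓘(ℝ, EM), M; ℝ⟯) :
    lieDer ρ X (f * g) = f * lieDer ρ X g + g * lieDer ρ X f := by
  ext x
  have hf : MDifferentiableAt 𝓘(ℝ, EM) 𝓘(ℝ, ℝ) f x := f.contMDiff.mdifferentiable (by simp) x
  have hg : MDifferentiableAt 𝓘(ℝ, EM) 𝓘(ℝ, ℝ) g x := g.contMDiff.mdifferentiable (by simp) x
  exact congrArg (fun l => l (ρ x (X x))) (hf.hasMFDerivAt.mul hg.hasMFDerivAt).mfderiv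

variable (EM F A) in
/-- A (real, smooth) Lie algebroid structure `μ` on the vector bundle `A → M`: an anchor and a
Lie bracket on sections, with the Leibniz rule and an anchor compatible with brackets. -/
structure LieAlgebroid where
  anchor : BundleAnchor EM F A
  bracket : Sec EM F A → Sec EM F A → Sec EM F A
  bracket_add : ∀ X Y Z, bracket X (Y + Z) = bracket X Y + bracket X Z
  bracket_antisymm : ∀ X Y, bracket X Y = -bracket Y X
  jacobi : ∀ X Y Z,
    bracket X (bracket Y Z) = bracket (bracket X Y) Z + bracket Y (bracket X Z)
  leibniz : ∀ X (f : C^∞⟮𝓘(ℝ, EM), M; ℝ⟯) Y,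
    bracket X (f • Y) = f • bracket X Y + lieDer anchor X f • Y
  anchor_bracket : ∀ X Y f, lieDer anchor (bracket X Y) f =
    lieDer anchor X (lieDer anchor Y f) - lieDer anchor Y (lieDer anchor X f)

/-- The map on sections induced by a vector bundle endomorphism. -/
def BundleEnd.onSec (N : BundleEnd EM F A) :
    Sec EM F A →ₗ[C^∞⟮𝓘(ℝ, EM), M; ℝ⟯] Sec EM F A where
  toFun X := ⟨fun x => N x (X x), N.contMDiff.clm_bundle_apply X.contMDiff⟩
  map_add' X Y := by ext x; exact map_add (N x) (X x) (Y x)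
  map_smul' f X := by ext x; exact map_smul (N x) (f x) (X x)

/-- The map `Γ(A) → Γ(A*)`, `X ↦ Ω(X, · )`, induced by a bilinear form on `A`. -/
def BundleBilin.onSec (Ω : BundleBilin EM F A) :
    Sec EM F A →ₗ[C^∞⟮𝓘(ℝ, EM), M; ℝ⟯] DualSec EM F A where
  toFun X :=
    { toFun := fun Y => ⟨fun x => Ω x (X x) (Y x), by
        have h := ContMDiff.clm_bundle_apply₂ (F₁ := F) (F₂ := F) (F₃ := ℝ)
          (E₃ := fun _ : M => ℝ) (b := fun x => x) Ω.contMDiff X.contMDiff Y.contMDiff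
        exact fun x => (Bundle.contMDiffAt_section (F := ℝ) (E := fun _ : M => ℝ) x).1 (h x)⟩
      map_add' := fun Y Z => by ext x; exact map_add (Ω x (X x)) (Y x) (Z x)
      map_smul' := fun f Y => by ext x; exact map_smul (Ω x (X x)) (f x) (Y x) }
  map_add' X Y := by ext Z x; exact congrArg (fun l => l (Z x)) (map_add (Ω x) (X x) (Y x))
  map_smul' f X := by ext Z x; exact congrArg (fun l => l (Z x)) (map_smul (Ω x) (f x) (X x))

namespace LieAlgebroid

variable (μ : LieAlgebroid EM F A)

/-- The derivation `ρ(X)` of the algebra of smooth functions. -/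
abbrev der (X : Sec EM F A) (f : C^∞⟮𝓘(ℝ, EM), M; ℝ⟯) : C^∞⟮𝓘(ℝ, EM), M; ℝ⟯ :=
  lieDer μ.anchor X f

theorem bracket_smul_left (f : C^∞⟮𝓘(ℝ, EM), M; ℝ⟯) (X Y : Sec EM F A) :
    μ.bracket (f • X) Y = f • μ.bracket X Y - μ.der Y f • X := by
  rw [μ.bracket_antisymm, μ.leibniz, μ.bracket_antisymm Y X, smul_neg]
  abel

theorem bracket_add_left (X Y Z : Sec EM F A) :
    μ.bracket (X + Y) Z = μ.bracket X Z + μ.bracket Y Z := by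
  rw [μ.bracket_antisymm, μ.bracket_add, μ.bracket_antisymm X, μ.bracket_antisymm Y]
  abel

/-- `d_μ f`, with `⟨d_μ f, X⟩ = ρ(X) f`. -/
def dFun (f : C^∞⟮𝓘(ℝ, EM), M; ℝ⟯) : DualSec EM F A where
  toFun X := μ.der X f
  map_add' X Y := lieDer_add_left _ X Y f
  map_smul' g X := lieDer_smul_left _ g X f

/-- The Lie derivative `L_X η` of a `1`-form: `(L_X η)(Y) = ρ(X)(η Y) - η [X, Y]`. -/
def lieOne (X : Sec EM F A) (η : DualSec EM F A) : DualSec EM F A where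
  toFun Y := μ.der X (η Y) - η (μ.bracket X Y)
  map_add' Y Z := by
    simp only [map_add, μ.bracket_add, der, lieDer_add]; abel
  map_smul' f Y := by
    simp only [map_smul, map_add, μ.leibniz, der, lieDer_mul, smul_eq_mul, RingHom.id_apply]; ring

/-- The `1`-form `i_Y d_μ ξ`:
`(i_Y d_μ ξ)(Z) = ρ(Y)(ξ Z) - ρ(Z)(ξ Y) - ξ [Y, Z]`. -/
def contrD (Y : Sec EM F A) (ξ : DualSec EM F A) : DualSec EM F A where
  toFun Z := μ.der Y (ξ Z) - μ.der Z (ξ Y) - ξ (μ.bracket Y Z)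
  map_add' Z W := by
    simp only [map_add, μ.bracket_add, der, lieDer_add, lieDer_add_left]; abel
  map_smul' f Z := by
    simp only [map_smul, map_add, μ.leibniz, der, lieDer_mul, lieDer_smul_left, smul_eq_mul,
      RingHom.id_apply]
    ring

/-- The exterior derivative `d_μ` of a `2`-form (given as a bilinear map on sections), evaluated
on three sections. -/
def dTwo (Φ : Sec EM F A → Sec EM F A → C^∞⟮𝓘(ℝ, EM), M; ℝ⟯) (X Y Z : Sec EM F A) :
    C^∞⟮𝓘(ℝ, EM), M; ℝ⟯ :=
  μ.der X (Φ Y Z) - μ.der Y (Φ X Z) + μ.der Z (Φ X Y)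
    - Φ (μ.bracket X Y) Z + Φ (μ.bracket X Z) Y - Φ (μ.bracket Y Z) X

/-- The Nijenhuis torsion `(T_μ N)(X, Y) = [N X, N Y] - N([N X, Y] + [X, N Y] - N[X, Y])`. -/
def torsion (N : Sec EM F A →ₗ[C^∞⟮𝓘(ℝ, EM), M; ℝ⟯] Sec EM F A) (X Y : Sec EM F A) :
    Sec EM F A :=
  μ.bracket (N X) (N Y) -
    N (μ.bracket (N X) Y + μ.bracket X (N Y) - N (μ.bracket X Y))

/-- `(Ω, N)` is an `ΩN`-structure on the Lie algebroid `(A, μ)`, for a `2`-form `Ω` and a vector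
bundle endomorphism `N` with `Ω N = ᵗN Ω`: `N` is a Nijenhuis tensor and the `2`-forms `Ω` and
`Ω_N = Ω(N · , · )` are `d_μ`-closed. -/
structure IsOmegaN (Ω : BundleBilin EM F A) (N : BundleEnd EM F A) : Prop where
  alt : ∀ x (v : A x), Ω x v v = 0
  comm : ∀ x (v w : A x), Ω x (N x v) w = Ω x v (N x w)
  torsion_eq_zero : ∀ X Y, μ.torsion (BundleEnd.onSec N) X Y = 0
  closed : ∀ X Y Z, μ.dTwo (fun X Y => BundleBilin.onSec Ω X Y) X Y Z = 0
  closed_N : ∀ X Y Z,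
    μ.dTwo (fun X Y => BundleBilin.onSec Ω (BundleEnd.onSec N X) Y) X Y Z = 0

end LieAlgebroid

/-! ## The double `A ⊕ A*` -/

variable (EM F A) in
/-- Sections `X + ξ` of `A ⊕ A*`. -/
abbrev DoubleSec := Sec EM F A × DualSec EM F A

variable (EM F A) in
/-- The canonical symmetric form `⟨X + ξ, Y + η⟩ = ⟨ξ, Y⟩ + ⟨η, X⟩` on `A ⊕ A*`. -/
def pairing : LinearMap.BilinForm C^∞⟮𝓘(ℝ, EM), M; ℝ⟯ (DoubleSec EM F A) :=
  LinearMap.mk₂ _ (fun u v => u.2 v.1 + v.2 u.1)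
    (fun u u' v => by simp; ring) (fun f u v => by simp; ring)
    (fun u v v' => by simp; ring) (fun f u v => by simp; ring)

/-- The Dorfman bracket `[X + ξ, Y + η] = [X, Y] + L_X η - i_Y d_μ ξ` of the double of the trivial
Lie bialgebroid `((A, μ), (A*, 0))`. -/
def LieAlgebroid.dorfman (μ : LieAlgebroid EM F A) (u v : DoubleSec EM F A) : DoubleSec EM F A :=
  (μ.bracket u.1 v.1, μ.lieOne u.1 v.2 - μ.contrD v.1 u.2)

/-- The element `μ ∈ 𝒜³` that defines the Courant algebroid `(A ⊕ A*, μ)`.  It is given by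
`{{μ, u}, v} = {{u, μ}, v} = [u, v]` (Dorfman bracket), `{{μ, X + ξ}, f} = ρ(X) f` and
`{μ, f} = d_μ f`. -/
def LieAlgebroid.theta (μ : LieAlgebroid EM F A) :
    Symb C^∞⟮𝓘(ℝ, EM), M; ℝ⟯ (DoubleSec EM F A) 3 :=
  Symb.mk (fun u => Symb.mk (fun v => μ.dorfman u v) (fun f => μ.der u.1 f))
    (fun f => ((0, μ.dFun f) : DoubleSec EM F A))

/-- The endomorphism of `A ⊕ A*` with matrix `(N, 0; Ω, -ᵗN)`:
`X + ξ ↦ N X + (Ω X - ᵗN ξ)`. -/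
def lowerTriangular (N : BundleEnd EM F A) (Ω : BundleBilin EM F A) :
    DoubleSec EM F A →ₗ[C^∞⟮𝓘(ℝ, EM), M; ℝ⟯] DoubleSec EM F A :=
  LinearMap.prod (BundleEnd.onSec N ∘ₗ LinearMap.fst _ _ _)
    (BundleBilin.onSec Ω ∘ₗ LinearMap.fst _ _ _
      - (BundleEnd.onSec N).dualMap ∘ₗ LinearMap.snd _ _ _)

end LieAlgebroid
end CourantDeformation

/-! A Lie algebroid enters only through its bracket and anchor on sections, so everything is done
for an `AnchoredBracket` `P` on a module `V`, with the function `P.theta` of degree 3. The Jacobi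
identity is not built in, because the deformed brackets below must also have a `theta`.

The diagonal part of the triangular endomorphism deforms `P` by `N`, and its lower left corner
contributes only the differential of `Ω`. As `Ω` is closed, `{Ñ, theta P} = theta (P_N)`
(`pbr_tildeEnd_theta`). The same lemma applies to `P_N`: by `dTwo_deform`, closedness of `Ω` and of
`Ω ∘ N` makes `Ω` closed for `P_N` as well. Thus `{{Ñ, μ}, Ñ} = -{Ñ, {Ñ, μ}}` is `-theta ((P_N)_N)`.

Vanishing torsion turns the double deformation into the single deformation by `N²`
(`theta_deform_deform`). Finally, a Lie structure is compatible with its deformation by any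
endomorphism (`IsLie.compatible_deform`), and compatible brackets have Poisson-commuting `theta`s
(`Compatible.pbr_theta`). -/

namespace CourantDeformation

/-! ## Components of symbols of low degree -/

namespace Symb

section Components

variable {R E : Type u}

/-- `u ↦ {C, u}` for `C` of degree `2`, with values in `E`. -/
def endo (C : Symb R E 2) (u : E) : E := C.onE u

/-- `f ↦ {C, f}` for `C` of degree `2`, with values in `R`. -/
def symbol (C : Symb R E 2) (f : R) : R := C.onR f

/-- `{{C, u}, v}` for `C` of degree `3`. -/
def derived (C : Symb R E 3) (u v : E) : E := (C.onE u).endo v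

/-- `{{C, u}, f}` for `C` of degree `3`. -/
def anchor (C : Symb R E 3) (u : E) (f : R) : R := (C.onE u).symbol f

/-- `{C, f}` for `C` of degree `3`. -/
def diff (C : Symb R E 3) (f : R) : E := C.onR f

theorem ext_two {C D : Symb R E 2} (hE : ∀ u, C.endo u = D.endo u)
    (hR : ∀ f, C.symbol f = D.symbol f) : C = D :=
  Prod.ext (funext hE) (funext hR)

theorem ext_three {C D : Symb R E 3} (hE : ∀ u v, C.derived u v = D.derived u v)
    (hER : ∀ u f, C.anchor u f = D.anchor u f) (hR : ∀ f, C.diff f = D.diff f) : C = D :=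
  Prod.ext (funext fun u => ext_two (hE u) (hER u)) (funext hR)

/-- Equality is tested in the ambient space `Symb`, where `{{C, u}, f}` and `{{C, f}, u}` are
independent data; hence both `hED` and `hRE`. -/
theorem ext_four {C D : Symb R E 4}
    (hEE : ∀ u v w, (C.onE u).derived v w = (D.onE u).derived v w)
    (hEA : ∀ u v f, (C.onE u).anchor v f = (D.onE u).anchor v f)
    (hED : ∀ u f, (C.onE u).diff f = (D.onE u).diff f)
    (hRE : ∀ f v, (C.onR f).endo v = (D.onR f).endo v)
    (hRR : ∀ f g, (C.onR f).symbol g = (D.onR f).symbol g) : C = D :=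
  Prod.ext (funext fun u => ext_three (hEE u) (hEA u) (hED u))
    (funext fun f => ext_two (hRE f) (hRR f))

end Components

section Neg

variable {R E : Type u} [CommRing R] [AddCommGroup E]

theorem neg_derived (C : Symb R E 3) (u v : E) : (-C).derived u v = -C.derived u v := rfl
theorem neg_anchor (C : Symb R E 3) (u : E) (f : R) : (-C).anchor u f = -C.anchor u f := rfl
theorem neg_diff (C : Symb R E 3) (f : R) : (-C).diff f = -C.diff f := rfl

end Neg

variable {R E : Type u} [CommRing R] [AddCommGroup E] [Module R E]
  (B : LinearMap.BilinForm R E)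

/-! ### Brackets of degrees 2 and 3. -/

section TwoThree

variable (C : Symb R E 2) (D : Symb R E 3)

theorem pbr_two_three_derived (u v : E) :
    (pbr B 3 2 3 rfl C D).derived u v =
      C.endo (D.derived u v) - D.derived u (C.endo v) - D.derived (C.endo u) v := by
  change C.endo (D.derived u v) + (-1 : ℤ) ^ 2 • -((-1 : ℤ) ^ 2 • D.derived u (C.endo v)) +
    (-1 : ℤ) ^ 3 • -((-1 : ℤ) ^ 3 • D.derived (C.endo u) v) = _
  module

theorem pbr_two_three_anchor (u : E) (f : R) :
    (pbr B 3 2 3 rfl C D).anchor u f =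
      C.symbol (D.anchor u f) - D.anchor u (C.symbol f) - D.anchor (C.endo u) f := by
  change C.symbol (D.anchor u f) + -D.anchor u (C.symbol f) +
    (-1 : ℤ) ^ 3 • -((-1 : ℤ) ^ 3 • D.anchor (C.endo u) f) = _
  module

theorem pbr_two_three_diff (f : R) :
    (pbr B 3 2 3 rfl C D).diff f = C.endo (D.diff f) - D.diff (C.symbol f) := by
  change C.endo (D.diff f) + -D.diff (C.symbol f) = _
  module

/-- In these degrees `pbr` is defined by the Jacobi recursion, so graded antisymmetry is not built
in and is checked component by component. -/
theorem pbr_three_two_eq_neg : pbr B 3 3 2 rfl D C = -pbr B 3 2 3 rfl C D := by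
  refine ext_three (fun u v => ?_) (fun u f => ?_) (fun f => ?_)
  · rw [neg_derived, pbr_two_three_derived]
    change D.derived (C.endo u) v + (-1 : ℤ) ^ 2 • (D.derived u (C.endo v) +
      (-1 : ℤ) ^ 2 • -((-1 : ℤ) ^ 2 • C.endo (D.derived u v))) = _
    module
  · rw [neg_anchor, pbr_two_three_anchor]
    change D.anchor (C.endo u) f + (-1 : ℤ) ^ 2 • (D.anchor u (C.symbol f) +
      -C.symbol (D.anchor u f)) = _
    module
  · rw [neg_diff, pbr_two_three_diff]
    change D.diff (C.symbol f) + -((-1 : ℤ) ^ 2 • C.endo (D.diff f)) = _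
    module

end TwoThree

/-! ### Brackets of two functions of degree 3. -/

section ThreeThree

variable (C D : Symb R E 3)

theorem pbr_three_three_onE (u : E) :
    (pbr B 4 3 3 rfl C D).onE u =
      pbr B 3 3 2 rfl C (D.onE u) + (-1 : ℤ) ^ 3 • pbr B 3 2 3 rfl (C.onE u) D := rfl

/-- These are the mixed Jacobi terms of the two derived brackets; for `C = D` they give twice the
Jacobiator. -/
theorem pbr_three_three_derived (u v w : E) :
    ((pbr B 4 3 3 rfl C D).onE u).derived v w =
      C.derived (D.derived u v) w + C.derived v (D.derived u w) - D.derived u (C.derived v w)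
      + D.derived (C.derived u v) w + D.derived v (C.derived u w)
      - C.derived u (D.derived v w) := by
  rw [pbr_three_three_onE, pbr_three_two_eq_neg]
  change -(pbr B 3 2 3 rfl (D.onE u) C).derived v w +
    (-1 : ℤ) ^ 3 • (pbr B 3 2 3 rfl (C.onE u) D).derived v w = _
  rw [pbr_two_three_derived, pbr_two_three_derived]
  change -(D.derived u (C.derived v w) - C.derived v (D.derived u w) -
    C.derived (D.derived u v) w) + (-1 : ℤ) ^ 3 • (C.derived u (D.derived v w) -
    D.derived v (C.derived u w) - D.derived (C.derived u v) w) = _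
  module

theorem pbr_three_three_anchor (u v : E) (f : R) :
    ((pbr B 4 3 3 rfl C D).onE u).anchor v f =
      C.anchor (D.derived u v) f + C.anchor v (D.anchor u f) - D.anchor u (C.anchor v f)
      + D.anchor (C.derived u v) f + D.anchor v (C.anchor u f)
      - C.anchor u (D.anchor v f) := by
  rw [pbr_three_three_onE, pbr_three_two_eq_neg]
  change -(pbr B 3 2 3 rfl (D.onE u) C).anchor v f +
    (-1 : ℤ) ^ 3 • (pbr B 3 2 3 rfl (C.onE u) D).anchor v f = _
  rw [pbr_two_three_anchor, pbr_two_three_anchor]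
  change -(D.anchor u (C.anchor v f) - C.anchor v (D.anchor u f) -
    C.anchor (D.derived u v) f) + (-1 : ℤ) ^ 3 • (C.anchor u (D.anchor v f) -
    D.anchor v (C.anchor u f) - D.anchor (C.derived u v) f) = _
  module

theorem pbr_three_three_diff (u : E) (f : R) :
    ((pbr B 4 3 3 rfl C D).onE u).diff f =
      C.diff (D.anchor u f) - D.derived u (C.diff f)
      + D.diff (C.anchor u f) - C.derived u (D.diff f) := by
  rw [pbr_three_three_onE, pbr_three_two_eq_neg]
  change -(pbr B 3 2 3 rfl (D.onE u) C).diff f +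
    (-1 : ℤ) ^ 3 • (pbr B 3 2 3 rfl (C.onE u) D).diff f = _
  rw [pbr_two_three_diff, pbr_two_three_diff]
  change -(D.derived u (C.diff f) - C.diff (D.anchor u f)) +
    (-1 : ℤ) ^ 3 • (C.derived u (D.diff f) - D.diff (C.anchor u f)) = _
  module

theorem pbr_three_three_onR_endo (f : R) (v : E) :
    ((pbr B 4 3 3 rfl C D).onR f).endo v =
      C.derived (D.diff f) v + D.derived (C.diff f) v := by
  change C.derived (D.diff f) v + -((-1 : ℤ) ^ 3 • D.derived (C.diff f) v) = _
  module

theorem pbr_three_three_onR_symbol (f g : R) :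
    ((pbr B 4 3 3 rfl C D).onR f).symbol g =
      C.anchor (D.diff f) g + D.anchor (C.diff f) g := by
  change C.anchor (D.diff f) g + -((-1 : ℤ) ^ 3 • D.anchor (C.diff f) g) = _
  module

end ThreeThree
end Symb

/-! ## Anchored brackets -/

/-- An antisymmetric bracket on an `R`-module `V` with an anchor `V → Der R` and the Leibniz rule.
The Jacobi identity is not assumed. -/
structure AnchoredBracket (R V : Type u) [CommRing R] [Algebra ℝ R] [AddCommGroup V]
    [Module R V] where
  bracket : V →+ V →+ V
  der : V →ₗ[R] Derivation ℝ R R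
  antisymm : ∀ X Y, bracket X Y = -bracket Y X
  leibniz : ∀ X (f : R) Y, bracket X (f • Y) = f • bracket X Y + der X f • Y

namespace AnchoredBracket

variable {R V : Type u} [CommRing R] [Algebra ℝ R] [AddCommGroup V] [Module R V]

theorem leibniz_left (P : AnchoredBracket R V) (f : R) (X Y : V) :
    P.bracket (f • X) Y = f • P.bracket X Y - P.der Y f • X := by
  rw [P.antisymm, P.leibniz, P.antisymm Y X]; module

theorem lie_real_smul (P : AnchoredBracket R V) (t : ℝ) (X Y : V) :
    P.bracket X (algebraMap ℝ R t • Y) = algebraMap ℝ R t • P.bracket X Y := by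
  simp [P.leibniz]

theorem real_smul_lie (P : AnchoredBracket R V) (t : ℝ) (X Y : V) :
    P.bracket (algebraMap ℝ R t • X) Y = algebraMap ℝ R t • P.bracket X Y := by
  simp [P.leibniz_left]

/-- The differential of a function. -/
def dFun (P : AnchoredBracket R V) (f : R) : Module.Dual R V where
  toFun X := P.der X f
  map_add' X Y := by simp
  map_smul' g X := by simp

/-- The Lie derivative of a `1`-form. -/
def lieOne (P : AnchoredBracket R V) (X : V) (η : Module.Dual R V) : Module.Dual R V where
  toFun Y := P.der X (η Y) - η (P.bracket X Y)
  map_add' Y Z := by simp only [map_add]; abel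
  map_smul' f Y := by
    simp only [map_smul, map_add, P.leibniz, Derivation.leibniz, smul_eq_mul, RingHom.id_apply]
    ring

/-- The contraction `i_Y dξ` of the differential of a `1`-form. -/
def contrD (P : AnchoredBracket R V) (Y : V) (ξ : Module.Dual R V) : Module.Dual R V where
  toFun Z := P.der Y (ξ Z) - P.der Z (ξ Y) - ξ (P.bracket Y Z)
  map_add' Z W := by simp only [map_add, Derivation.add_apply]; abel
  map_smul' f Z := by
    simp only [map_smul, map_add, P.leibniz, Derivation.leibniz, Derivation.smul_apply,
      smul_eq_mul, RingHom.id_apply]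
    ring

@[simp] theorem dFun_apply (P : AnchoredBracket R V) (f : R) (X : V) :
    P.dFun f X = P.der X f := rfl

@[simp] theorem lieOne_apply (P : AnchoredBracket R V) (X Y : V) (η : Module.Dual R V) :
    P.lieOne X η Y = P.der X (η Y) - η (P.bracket X Y) := rfl

@[simp] theorem contrD_apply (P : AnchoredBracket R V) (Y Z : V) (ξ : Module.Dual R V) :
    P.contrD Y ξ Z = P.der Y (ξ Z) - P.der Z (ξ Y) - ξ (P.bracket Y Z) := rfl

/-- The Dorfman bracket on `V × V*`. -/
def dorfman (P : AnchoredBracket R V) (u v : V × Module.Dual R V) : V × Module.Dual R V :=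
  (P.bracket u.1 v.1, P.lieOne u.1 v.2 - P.contrD v.1 u.2)

@[simp] theorem dorfman_fst (P : AnchoredBracket R V) (u v : V × Module.Dual R V) :
    (P.dorfman u v).1 = P.bracket u.1 v.1 := rfl

@[simp] theorem dorfman_snd (P : AnchoredBracket R V) (u v : V × Module.Dual R V) :
    (P.dorfman u v).2 = P.lieOne u.1 v.2 - P.contrD v.1 u.2 := rfl

/-- The function of degree `3` on `V × V*` attached to an anchored bracket. -/
def theta (P : AnchoredBracket R V) : Symb R (V × Module.Dual R V) 3 :=
  Symb.mk (fun u => Symb.mk (fun v => P.dorfman u v) (fun f => P.der u.1 f))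
    (fun f => ((0, P.dFun f) : V × Module.Dual R V))

@[simp] theorem derived_theta (P : AnchoredBracket R V) (u v : V × Module.Dual R V) :
    P.theta.derived u v = P.dorfman u v := rfl

@[simp] theorem anchor_theta (P : AnchoredBracket R V) (u : V × Module.Dual R V) (f : R) :
    P.theta.anchor u f = P.der u.1 f := rfl

@[simp] theorem diff_theta (P : AnchoredBracket R V) (f : R) :
    P.theta.diff f = (0, P.dFun f) := rfl

theorem dorfman_add_left (P : AnchoredBracket R V) (u v w : V × Module.Dual R V) :
    P.dorfman (u + v) w = P.dorfman u w + P.dorfman v w := by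
  refine Prod.ext (by simp) (LinearMap.ext fun Z => ?_)
  simp; ring

theorem dorfman_add_right (P : AnchoredBracket R V) (u v w : V × Module.Dual R V) :
    P.dorfman u (v + w) = P.dorfman u v + P.dorfman u w := by
  refine Prod.ext (by simp) (LinearMap.ext fun Z => ?_)
  simp; ring

theorem dorfman_real_smul_left (P : AnchoredBracket R V) (t : ℝ) (u v : V × Module.Dual R V) :
    P.dorfman (algebraMap ℝ R t • u) v = algebraMap ℝ R t • P.dorfman u v := by
  refine Prod.ext (by simp [real_smul_lie]) (LinearMap.ext fun Z => ?_)
  simp [real_smul_lie, Algebra.smul_def]; ring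

theorem dorfman_real_smul_right (P : AnchoredBracket R V) (t : ℝ) (u v : V × Module.Dual R V) :
    P.dorfman u (algebraMap ℝ R t • v) = algebraMap ℝ R t • P.dorfman u v := by
  refine Prod.ext (by simp [lie_real_smul]) (LinearMap.ext fun Z => ?_)
  simp [real_smul_lie, Algebra.smul_def]; ring

/-! ### Compatibility and Poisson commutation. -/

/-- Two anchored brackets are compatible if the mixed terms of the Jacobi identity and of the
morphism property of the anchor for their sum cancel. -/
structure Compatible (P Q : AnchoredBracket R V) : Prop where
  jacobi : ∀ X Y Z, P.bracket X (Q.bracket Y Z) + Q.bracket X (P.bracket Y Z) =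
    P.bracket (Q.bracket X Y) Z + Q.bracket (P.bracket X Y) Z +
      P.bracket Y (Q.bracket X Z) + Q.bracket Y (P.bracket X Z)
  der_bracket : ∀ X Y f, P.der (Q.bracket X Y) f + Q.der (P.bracket X Y) f =
    P.der X (Q.der Y f) + Q.der X (P.der Y f) - P.der Y (Q.der X f) - Q.der Y (P.der X f)

/-- An anchored bracket is a Lie–Rinehart structure if it satisfies the Jacobi identity and its
anchor preserves brackets. -/
structure IsLie (P : AnchoredBracket R V) : Prop where
  jacobi : ∀ X Y Z, P.bracket X (P.bracket Y Z) =
    P.bracket (P.bracket X Y) Z + P.bracket Y (P.bracket X Z)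
  der_bracket : ∀ X Y f, P.der (P.bracket X Y) f = P.der X (P.der Y f) - P.der Y (P.der X f)

theorem IsLie.compatible_self {P : AnchoredBracket R V} (h : P.IsLie) : P.Compatible P where
  jacobi X Y Z := by rw [h.jacobi X Y Z]; abel
  der_bracket X Y f := by rw [h.der_bracket]; abel

variable (B : LinearMap.BilinForm R (V × Module.Dual R V))

-- The vector part of the bracket is the mixed Jacobi identity and the function parts are the mixed
-- morphism property of the anchors. The form part follows from both by evaluation on a test vector.
open Symb in
theorem Compatible.pbr_theta {P Q : AnchoredBracket R V} (h : P.Compatible Q) :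
    pbr B 4 3 3 rfl P.theta Q.theta = 0 := by
  have anch : ∀ X Y f, P.der (Q.bracket X Y) f = P.der X (Q.der Y f) + Q.der X (P.der Y f)
      - P.der Y (Q.der X f) - Q.der Y (P.der X f) - Q.der (P.bracket X Y) f :=
    fun X Y f => eq_sub_of_add_eq (h.der_bracket X Y f)
  refine ext_four (fun u v w => ?_) (fun u v f => ?_) (fun u f => ?_) (fun f v => ?_)
    (fun f g => ?_)
  · rw [pbr_three_three_derived]
    simp only [derived_theta]
    change _ = (0 : V × Module.Dual R V)
    refine Prod.ext ?_ (LinearMap.ext fun Z => ?_)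
    · simp only [Prod.fst_sub, Prod.fst_add, dorfman_fst, Prod.fst_zero]
      rw [← neg_eq_zero, ← sub_eq_zero.2 (h.jacobi u.1 v.1 w.1)]
      abel
    · simp only [Prod.snd_sub, Prod.snd_add, dorfman_snd, dorfman_fst, Prod.snd_zero, 
        LinearMap.sub_apply, LinearMap.add_apply, lieOne_apply, contrD_apply, map_sub,
        LinearMap.zero_apply, anch]
      -- After `anch` the iterated derivatives cancel. What remains is each of the three forms
      -- applied to the mixed Jacobi identity of the other two vectors and `Z`.
      have h1 := congrArg w.2 (h.jacobi u.1 v.1 Z)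
      have h2 := congrArg v.2 (h.jacobi u.1 w.1 Z)
      have h3 := congrArg u.2 (h.jacobi v.1 w.1 Z)
      simp only [map_add] at h1 h2 h3
      linear_combination h1 - h2 + h3
  · rw [pbr_three_three_anchor]
    change _ = (0 : R)
    simp only [derived_theta, anchor_theta, dorfman_fst, anch]
    ring
  · rw [pbr_three_three_diff]
    simp only [derived_theta, anchor_theta, diff_theta]
    change _ = (0 : V × Module.Dual R V)
    refine Prod.ext (by simp) (LinearMap.ext fun Z => ?_)
    simp [anch]
    ring
  · rw [pbr_three_three_onR_endo]
    simp only [derived_theta, diff_theta]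
    change _ = (0 : V × Module.Dual R V)
    refine Prod.ext (by simp) (LinearMap.ext fun Z => ?_)
    simp [anch]
    ring
  · rw [pbr_three_three_onR_symbol]
    change _ = (0 : R)
    simp

variable {B}

/-- Only antisymmetry and the Leibniz rule are needed; the Jacobi identity matters only for `{θ, θ}
= 0`. -/
theorem isFun_theta (P : AnchoredBracket R V) (hB : ∀ u v, B u v = u.2 v.1 + v.2 u.1) :
    IsFun B 3 P.theta := by
  refine ⟨fun u => ⟨fun _ => trivial, fun _ => trivial, P.dorfman_add_right u,
    fun t v => P.dorfman_real_smul_right t u v, map_add (P.der u.1), fun t f => ?_, fun f g => ?_,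
    fun v w => ?_, trivial, trivial⟩, fun _ => trivial, fun u v => ?_, fun t u => ?_,
    fun f g => ?_, fun t f => ?_, fun f g => ?_, fun u v => ?_, fun u f => ?_, trivial⟩
  · change P.der u.1 (algebraMap ℝ R t * f) = algebraMap ℝ R t * P.der u.1 f
    simp
  · exact (P.der u.1).leibniz f g
  · change B (P.dorfman u v) w + B (P.dorfman u w) v = P.der u.1 (B v w)
    simp [hB, P.antisymm v.1 w.1]
    ring
  · refine Symb.ext_two (fun w => P.dorfman_add_left u v w) (fun f => ?_)
    change P.der (u + v).1 f = P.der u.1 f + P.der v.1 f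
    simp
  · refine Symb.ext_two (fun w => P.dorfman_real_smul_left t u w) (fun f => ?_)
    change P.der (algebraMap ℝ R t • u).1 f = algebraMap ℝ R t * P.der u.1 f
    simp [Algebra.smul_def]
  · exact (Prod.ext (by simp) (LinearMap.ext fun Z => by simp) :
      ((0, P.dFun (f + g)) : V × Module.Dual R V) = (0, P.dFun f) + (0, P.dFun g))
  · exact (Prod.ext (by simp) (LinearMap.ext fun Z => by simp [Algebra.smul_def]) :
      ((0, P.dFun (algebraMap ℝ R t * f)) : V × Module.Dual R V) =
        algebraMap ℝ R t • (0, P.dFun f))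
  · exact (Prod.ext (by simp) (LinearMap.ext fun Z => by simp) :
      ((0, P.dFun (f * g)) : V × Module.Dual R V) = f • (0, P.dFun g) + g • (0, P.dFun f))
  · change P.dorfman u v + P.dorfman v u = (0, P.dFun (B u v))
    refine Prod.ext (by simp [P.antisymm u.1 v.1]) (LinearMap.ext fun Z => ?_)
    simp [hB]
    ring
  · change P.der u.1 f = B (0, P.dFun f) u
    simp [hB]

/-! ### Deformation by an endomorphism. -/

/-- The deformation `[X, Y]_N = [N X, Y] + [X, N Y] - N [X, Y]` of an anchored bracket by an
endomorphism, with anchor `X ↦ ρ(N X)`. -/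
def deform (P : AnchoredBracket R V) (N : V →ₗ[R] V) : AnchoredBracket R V where
  bracket := AddMonoidHom.mk' (fun X => P.bracket (N X) +
      (P.bracket X).comp N.toAddMonoidHom - N.toAddMonoidHom.comp (P.bracket X)) fun X Y => by
    ext Z; simp; abel
  der := P.der ∘ₗ N
  antisymm X Y := by
    simp [P.antisymm Y, P.antisymm (N Y)]; abel
  leibniz X f Y := by
    simp [P.leibniz, smul_sub]; abel

theorem bracket_deform (P : AnchoredBracket R V) (N : V →ₗ[R] V) (X Y : V) :
    (P.deform N).bracket X Y = P.bracket (N X) Y + P.bracket X (N Y) - N (P.bracket X Y) := rfl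

theorem der_deform (P : AnchoredBracket R V) (N : V →ₗ[R] V) (X : V) :
    (P.deform N).der X = P.der (N X) := rfl

/-- The mixed Jacobi identity is the sum of the Jacobi identities for `(K X, Y, Z)`, `(X, K Y, Z)`
and `(X, Y, K Z)`, minus `K` of the one for `(X, Y, Z)`; the terms `[X, K [Y, Z]]` and their
analogues cancel. No torsion condition on `K` is involved. -/
theorem IsLie.compatible_deform {P : AnchoredBracket R V} (h : P.IsLie) (K : V →ₗ[R] V) :
    P.Compatible (P.deform K) where
  jacobi X Y Z := by
    simp only [bracket_deform, map_add, map_sub, AddMonoidHom.add_apply, AddMonoidHom.sub_apply,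
      h.jacobi X Y Z, h.jacobi (K X) Y Z, h.jacobi X (K Y) Z, h.jacobi X Y (K Z)]
    abel
  der_bracket X Y f := by
    simp only [bracket_deform, der_deform, map_add, map_sub, Derivation.add_apply,
      Derivation.sub_apply, h.der_bracket]
    abel

/-- The Nijenhuis torsion of an endomorphism. -/
def torsion (P : AnchoredBracket R V) (N : V →ₗ[R] V) (X Y : V) : V :=
  P.bracket (N X) (N Y) - N (P.bracket (N X) Y + P.bracket X (N Y) - N (P.bracket X Y))

/-- The brackets of `(P_N)_N` and of `P_{N²}` differ by exactly twice the torsion of `N`, and their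
anchors are both `ρ ∘ N²`. -/
theorem theta_deform_deform {P : AnchoredBracket R V} {N : V →ₗ[R] V}
    (hN : ∀ X Y, P.torsion N X Y = 0) :
    ((P.deform N).deform N).theta = (P.deform (N ∘ₗ N)).theta := by
  have h : ∀ X Y, P.bracket (N X) (N Y) =
      N (P.bracket (N X) Y) + N (P.bracket X (N Y)) - N (N (P.bracket X Y)) := fun X Y => by
    simpa using sub_eq_zero.1 (hN X Y)
  have hb : ∀ X Y, ((P.deform N).deform N).bracket X Y = (P.deform (N ∘ₗ N)).bracket X Y := by
    intro X Y
    simp only [bracket_deform, LinearMap.comp_apply, h, map_add, map_sub]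
    abel
  refine Symb.ext_three (fun u v => Prod.ext (hb _ _) (LinearMap.ext fun Z => ?_))
    (fun _ _ => rfl) (fun _ => rfl)
  simp only [derived_theta, dorfman_snd, LinearMap.sub_apply, lieOne_apply, contrD_apply, hb]
  rfl

/-- This absorbs the sign from `pbr_three_two_eq_neg` into the endomorphism, so that compatibility
applies directly. -/
theorem theta_deform_neg (P : AnchoredBracket R V) (K : V →ₗ[R] V) :
    (P.deform (-K)).theta = -(P.deform K).theta := by
  have hb : ∀ X Y, (P.deform (-K)).bracket X Y = -(P.deform K).bracket X Y := by
    intro X Y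
    simp [bracket_deform]
    abel
  refine Symb.ext_three (fun u v => ?_) (fun u f => ?_) (fun f => ?_)
  · rw [Symb.neg_derived, derived_theta, derived_theta]
    refine Prod.ext (by simp [hb]) (LinearMap.ext fun Z => ?_)
    simp [hb, der_deform]
    ring
  · rw [Symb.neg_anchor]
    simp [der_deform]
  · rw [Symb.neg_diff, diff_theta, diff_theta]
    exact Prod.ext (by simp) (LinearMap.ext fun Z => by simp [der_deform])

/-! ### Closed 2-forms and triangular endomorphisms. -/

/-- The differential of the `2`-form `(X, Y) ↦ Ω X Y`. -/
def dTwo (P : AnchoredBracket R V) (Ω : V →ₗ[R] Module.Dual R V) (X Y Z : V) : R :=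
  P.der X (Ω Y Z) - P.der Y (Ω X Z) + P.der Z (Ω X Y)
    - Ω (P.bracket X Y) Z + Ω (P.bracket X Z) Y - Ω (P.bracket Y Z) X

/-- This is `d_N = i_N d - d i_N` applied to `Ω`; the factor 2 arises because `hc` gives `i_N Ω = 2
Ω_N`. -/
theorem dTwo_deform (P : AnchoredBracket R V) (Ω : V →ₗ[R] Module.Dual R V) (N : V →ₗ[R] V)
    (hc : ∀ X Y, Ω (N X) Y = Ω X (N Y)) (X Y Z : V) :
    (P.deform N).dTwo Ω X Y Z =
      P.dTwo Ω (N X) Y Z + P.dTwo Ω X (N Y) Z + P.dTwo Ω X Y (N Z)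
        - 2 * P.dTwo (Ω ∘ₗ N) X Y Z := by
  simp only [dTwo, bracket_deform, der_deform, map_add, map_sub, LinearMap.add_apply,
    LinearMap.sub_apply, LinearMap.comp_apply, hc]
  ring

/-- The endomorphism `X + ξ ↦ N X + (Ω X - ᵗN ξ)` of `V × V*`. -/
def triangular (N : V →ₗ[R] V) (Ω : V →ₗ[R] Module.Dual R V) :
    V × Module.Dual R V →ₗ[R] V × Module.Dual R V :=
  LinearMap.prod (N ∘ₗ LinearMap.fst _ _ _)
    (Ω ∘ₗ LinearMap.fst _ _ _ - N.dualMap ∘ₗ LinearMap.snd _ _ _)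

@[simp] theorem triangular_fst (N : V →ₗ[R] V) (Ω : V →ₗ[R] Module.Dual R V)
    (u : V × Module.Dual R V) : (triangular N Ω u).1 = N u.1 := rfl

@[simp] theorem triangular_snd (N : V →ₗ[R] V) (Ω : V →ₗ[R] Module.Dual R V)
    (u : V × Module.Dual R V) : (triangular N Ω u).2 = Ω u.1 - N.dualMap u.2 := rfl

theorem isSkew_triangular (hB : ∀ u v, B u v = u.2 v.1 + v.2 u.1) (N : V →ₗ[R] V)
    {Ω : V →ₗ[R] Module.Dual R V} (hΩ : ∀ X Y, Ω X Y = -Ω Y X) : IsSkew B (triangular N Ω) := by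
  intro u v
  simp [hB, hΩ u.1 v.1]
  ring

/-- The block `(N, -ᵗN)` alone produces the deformed bracket; `Ω` adds only its differential, in the
form component. -/
theorem pbr_tildeEnd_theta (P : AnchoredBracket R V) (N : V →ₗ[R] V)
    {Ω : V →ₗ[R] Module.Dual R V} (hΩ : ∀ X Y, Ω X Y = -Ω Y X)
    (hd : ∀ X Y Z, P.dTwo Ω X Y Z = 0) :
    pbr B 3 2 3 rfl (tildeEnd (triangular N Ω)) P.theta = (P.deform N).theta := by
  have hE : ∀ u, (tildeEnd (triangular N Ω)).endo u = -triangular N Ω u := fun _ => rfl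
  have hR : ∀ f : R, (tildeEnd (triangular N Ω)).symbol f = 0 := fun _ => rfl
  refine Symb.ext_three (fun u v => ?_) (fun u f => ?_) (fun f => ?_)
  · rw [Symb.pbr_two_three_derived, hE, hE, hE]
    simp only [derived_theta]
    refine Prod.ext ?_ (LinearMap.ext fun Z => ?_)
    · simp [bracket_deform]
      abel
    · have h := hd u.1 v.1 Z
      -- Antisymmetry brings these brackets into the second slot, where the Lie derivative and the
      -- contraction place them.
      rw [dTwo, hΩ (P.bracket u.1 Z) v.1, hΩ (P.bracket v.1 Z) u.1] at h
      simp [bracket_deform, der_deform]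
      linear_combination h
  · rw [Symb.pbr_two_three_anchor, hE, hR, hR]
    simp [der_deform]
  · rw [Symb.pbr_two_three_diff, hE, hR]
    refine Prod.ext (by simp) (LinearMap.ext fun Z => ?_)
    simp [der_deform]

theorem IsLie.isWeakDeformingTensor {P : AnchoredBracket R V} (h : P.IsLie)
    (hB : ∀ u v, B u v = u.2 v.1 + v.2 u.1) {N : V →ₗ[R] V} {Ω : V →ₗ[R] Module.Dual R V}
    (hΩ : ∀ X Y, Ω X Y = -Ω Y X) (hc : ∀ X Y, Ω (N X) Y = Ω X (N Y))
    (hN : ∀ X Y, P.torsion N X Y = 0) (hd : ∀ X Y Z, P.dTwo Ω X Y Z = 0)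
    (hdN : ∀ X Y Z, P.dTwo (Ω ∘ₗ N) X Y Z = 0) :
    IsWeakDeformingTensor B P.theta (triangular N Ω) := by
  refine ⟨⟨P.isFun_theta hB, h.compatible_self.pbr_theta B⟩, isSkew_triangular hB N hΩ, ?_⟩
  have hd' : ∀ X Y Z, (P.deform N).dTwo Ω X Y Z = 0 := fun X Y Z => by
    simp [dTwo_deform P Ω N hc, hd, hdN]
  -- The inner element becomes `theta` of the deformation of `P` by `-(N ∘ N)`.
  rw [pbr_tildeEnd_theta P N hΩ hd, Symb.pbr_three_two_eq_neg, pbr_tildeEnd_theta _ N hΩ hd',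
    theta_deform_deform hN, ← theta_deform_neg]
  exact (h.compatible_deform _).pbr_theta B

end AnchoredBracket

/-! ### From Lie algebroids to anchored brackets. -/

section LieAlgebroid

open Bundle

variable {EM : Type*} [NormedAddCommGroup EM] [NormedSpace ℝ EM]
  {M : Type u} [TopologicalSpace M] [ChartedSpace EM M]
  {F : Type*} [NormedAddCommGroup F] [NormedSpace ℝ F]
  {A : M → Type u} [TopologicalSpace (TotalSpace F A)]
  [∀ x, AddCommGroup (A x)] [∀ x, Module ℝ (A x)] [∀ x, TopologicalSpace (A x)]
  [FiberBundle F A] [VectorBundle ℝ F A]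
  [∀ x, IsTopologicalAddGroup (A x)] [∀ x, ContinuousSMul ℝ (A x)]
  [IsManifold 𝓘(ℝ, EM) ∞ M] [ContMDiffVectorBundle ∞ F A 𝓘(ℝ, EM)]

theorem lieDer_algebraMap (ρ : BundleAnchor EM F A) (X : Sec EM F A) (t : ℝ) :
    lieDer ρ X (algebraMap ℝ C^∞⟮𝓘(ℝ, EM), M; ℝ⟯ t) = 0 := by
  ext x
  exact congrArg (fun l => l (ρ x (X x)))
    (mfderiv_const (I := 𝓘(ℝ, EM)) (I' := 𝓘(ℝ, ℝ)) (x := x) (c := t))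

/-- The derivation of the algebra of smooth functions given by an anchor and a section. -/
def lieDerivation (ρ : BundleAnchor EM F A) (X : Sec EM F A) :
    Derivation ℝ C^∞⟮𝓘(ℝ, EM), M; ℝ⟯ C^∞⟮𝓘(ℝ, EM), M; ℝ⟯ :=
  Derivation.mk'
    { toFun := lieDer ρ X
      map_add' := lieDer_add ρ X
      map_smul' := fun t f => by
        rw [Algebra.smul_def, lieDer_mul, lieDer_algebraMap, mul_zero, add_zero,
          RingHom.id_apply, Algebra.smul_def] }
    (lieDer_mul ρ X)

/-- The anchored bracket on sections underlying a Lie algebroid. -/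
def LieAlgebroid.toAnchoredBracket (μ : LieAlgebroid EM F A) :
    AnchoredBracket C^∞⟮𝓘(ℝ, EM), M; ℝ⟯ (Sec EM F A) where
  bracket := AddMonoidHom.mk' (fun X => AddMonoidHom.mk' (μ.bracket X) (μ.bracket_add X))
    fun X Y => AddMonoidHom.ext (μ.bracket_add_left X Y)
  der :=
    { toFun := lieDerivation μ.anchor
      map_add' := fun X Y => Derivation.ext (lieDer_add_left μ.anchor X Y)
      map_smul' := fun g X => Derivation.ext (lieDer_smul_left μ.anchor g X) }
  antisymm := μ.bracket_antisymm
  leibniz := μ.leibniz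

theorem LieAlgebroid.isLie_toAnchoredBracket (μ : LieAlgebroid EM F A) :
    μ.toAnchoredBracket.IsLie :=
  ⟨μ.jacobi, μ.anchor_bracket⟩

theorem LieAlgebroid.theta_toAnchoredBracket (μ : LieAlgebroid EM F A) :
    μ.toAnchoredBracket.theta = μ.theta := rfl

/-- Polarization of the alternating condition in each fibre. -/
theorem BundleBilin.onSec_antisymm {Ω : BundleBilin EM F A} (h : ∀ x (v : A x), Ω x v v = 0)
    (X Y : Sec EM F A) : BundleBilin.onSec Ω X Y = -BundleBilin.onSec Ω Y X := by
  ext x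
  change Ω x (X x) (Y x) = -Ω x (Y x) (X x)
  have hXY := h x (X x + Y x)
  simp only [map_add, add_apply, h, zero_add, add_zero] at hXY
  linarith

end LieAlgebroid
end CourantDeformation

/-- On the double `A ⊕ A*` of a Lie algebroid `(A, μ)`, an `ΩN`-structure `(ω, N)` gives a weak
deforming tensor. -/
theorem proposition4p9 {EM : Type*} [NormedAddCommGroup EM] [NormedSpace ℝ EM]
    [FiniteDimensional ℝ EM]
    {M : Type u} [TopologicalSpace M] [ChartedSpace EM M] [IsManifold 𝓘(ℝ, EM) ∞ M]
    [T2Space M] [SecondCountableTopology M]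
    {F : Type*} [NormedAddCommGroup F] [NormedSpace ℝ F] [FiniteDimensional ℝ F]
    {A : M → Type u} [TopologicalSpace (Bundle.TotalSpace F A)]
    [∀ x, AddCommGroup (A x)] [∀ x, Module ℝ (A x)] [∀ x, TopologicalSpace (A x)]
    [∀ x, IsTopologicalAddGroup (A x)] [∀ x, ContinuousSMul ℝ (A x)]
    [FiberBundle F A] [VectorBundle ℝ F A] [ContMDiffVectorBundle ∞ F A 𝓘(ℝ, EM)]
    (μ : CourantDeformation.LieAlgebroid EM F A)
    (N : CourantDeformation.BundleEnd EM F A) (Ω : CourantDeformation.BundleBilin EM F A)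
    (h : μ.IsOmegaN Ω N) :
    CourantDeformation.IsWeakDeformingTensor (CourantDeformation.pairing EM F A) μ.theta
      (CourantDeformation.lowerTriangular N Ω) := by
  rw [← μ.theta_toAnchoredBracket]
  -- `lowerTriangular`, the torsion and the differentials of the Lie algebroid agree with their
  -- algebraic counterparts by definition, so the hypotheses pass through unchanged.
  exact μ.isLie_toAnchoredBracket.isWeakDeformingTensor (fun _ _ => rfl)
    (CourantDeformation.BundleBilin.onSec_antisymm h.alt)
    (fun X Y => by ext x; exact h.comm x (X x) (Y x))
    h.torsion_eq_zero h.closed h.closed_N
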